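/- **Setting.** Let $X$ be a real Hilbert space, $T>0$, $u\in W^{1,1}([0,T],\mathbb R^m)$, let $\mathfrak A:X\rightrightarrows X$ be a multivalued operator (a subset of $X\times X$) whose domain is a linear subspace, and let $\mathfrak p:\operatorname{dom}\mathfrak A\to\mathbb R^m$ be linear and surjective. Let $p_1,\dots,p_m\in\operatorname{dom}\mathfrak A$ with $\mathfrak p p_i=e_i$, and put $$\widetilde x(t)=\sum_{i=1}^m u_i(t)\,p_i,\qquad A_t=\{(x,w)\in\mathfrak A:\ \mathfrak p x=u(t)\},$$ and, for $z\in\ker\mathfrak p=\{z\in\operatorname{dom}\mathfrak A:\mathfrak p z=0\}$, $$\widetilde{\mathfrak A}_t(z)=\mathfrak A(z+\widetilde x(t)),\qquad \mathcal A_t(z)=\widetilde{\mathfrak A}_t(z)+\dot{\widetilde x}(t),$$ where $\dot u$ is any fixed representative of the weak derivative of $u$ and $\dot{\widetilde x}=\sum_i\dot u_i\,p_i$. The boundary control system $\dot x\in-\mathfrak A x$, $\mathfrak p x=u$, $x(0)=x_0$ is understood as $\dot x(t)\in-A_t(x(t))$, $x(0)=x_0$. **Solutions.** A *strong solution* of $\dot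 x(t)\in-B_t(x(t))$, $x(0)=x_0$, is a function $x\in W^{1,1}([0,T],X)$ with $x(0)=x_0\in\overline{\operatorname{dom}B_0}$ and $\dot x(t)\in-B_t(x(t))$ for a.e. $t\in[0,T]$. For partitions $0=t^n_0<\dots<t^n_{m(n)}=T$ and coefficients $g^n_k\in X$, consider the scheme $$x^n_0=x_0,\qquad \frac{x^n_k-x^n_{k-1}}{t^n_k-t^n_{k-1}}\in-B_{t^n_k}(x^n_k)+g^n_k,\quad k=1,\dots,m(n).\tag{S}$$ The step function of a family $(v^n_k)_k$ is $v^n_0$ at $t=0$ and $v^n_k$ on $(t^n_{k-1},t^n_k]$. We say that $x\in C([0,T],X)$ is a *limit of* (S) along the given partitions if $\max_k(t^n_k-t^n_{k-1})\to0$ and there are solutions $(x^n_k)$ of (S) whose step functions converge to $x$ uniformly on $[0,T]$. A *generalized solution* of the inhomogeneous problem $\dot x(t)\in-B_t(x(t))+f(t)$, $x(0)=x_0$, with $f\in L^1([0,T],X)$, is a limit of (S) along some partitions with some $g^n_k$ whose step functions converge to $f$ in $L^1([0,T],X)$. **Lemma.** The function $\widetilde x$ belongs to $W^{1,1}([0,T],X)$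 with derivative $\dot{\widetilde x}$, and $\operatorname{dom}\mathcal A_t=\ker\mathfrak p$ for all $t\in[0,T]$. For all $x_0\in X$ and $x:[0,T]\to X$, with $z=x-\widetilde x$ and $z_0=x_0-\widetilde x(0)$: 1. $x$ is a strong solution of $\dot x(t)\in-A_t(x(t))$, $x(0)=x_0$, if and only if $z$ is a strong solution of $\dot z(t)\in-\mathcal A_t(z(t))$, $z(0)=z_0$. 2. $x$ is a generalized solution of $\dot x(t)\in-A_t(x(t))$, $x(0)=x_0$ (with inhomogeneity $f=0$), if and only if $z$ is a generalized solution of $\dot z(t)\in-\mathcal A_t(z(t))=-\widetilde{\mathfrak A}_t(z(t))-\dot{\widetilde x}(t)$, $z(0)=z_0$ (with operators $\widetilde{\mathfrak A}_t$ and inhomogeneity $f=-\dot{\widetilde x}$). 3. Suppose that $A_t$ is maximal monotone for every $t\in[0,T]$. Then * (a) $x$ is a limit of (S) with $B_t=A_t$ and all $g^n_k=0$ along some partitions if and only if $z$ is a generalized solution of $\dot z(t)\in-\widetilde{\mathfrak A}_t(z(t))-\dot{\widetilde x}(t)$, $z(0)=z_0$. * (b) For every sequence of partitions along which the step functions with values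 $\dot{\widetilde x}(t^n_k)$ converge to $\dot{\widetilde x}$ in $L^1([0,T],X)$, $x$ is a limit of (S) with $B_t=A_t$, $g^n_k=0$ and initial value $x_0$ along these partitions if and only if $z$ is a limit of (S) with $B_t=\mathcal A_t$, $g^n_k=0$ and initial value $z_0$ along these partitions. -/

import Mathlib

open MeasureTheory Filter Topology

namespace BoundaryLifting

/-! ## Multivalued operators -/

section Relations

variable {X : Type*} [NormedAddCommGroup X] [InnerProductSpace ℝ X]

/-- The image `A x` of a point under a multivalued operator `A : X ⇉ X`. -/
def relImage (A : Set (X × X)) (x : X) : Set X := {y | (x, y) ∈ A}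

/-- The domain of a multivalued operator. -/
def relDom (A : Set (X × X)) : Set X := {x | (relImage A x).Nonempty}

/-- Monotone multivalued operators. -/
def IsMonotoneRel (A : Set (X × X)) : Prop :=
  ∀ a ∈ A, ∀ b ∈ A, 0 ≤ inner ℝ (a.1 - b.1) (a.2 - b.2)

/-- Maximal monotone: monotone and not properly contained in another monotone operator. -/
def IsMaximalMonotoneRel (A : Set (X × X)) : Prop :=
  IsMonotoneRel A ∧ ∀ B : Set (X × X), IsMonotoneRel B → A ⊆ B → B = A

end Relations

/-! ## Functions of time

A function on `[0,T]` is represented by a function on `ℝ`, of which only the values on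
`[0,T]` are used. -/

/-- `x ∈ W^{1,1}([0,T],X)` with (weak) derivative `v`: `v` is Bochner integrable and `x` is
(the continuous representative) `x(0) + ∫₀ᵗ v`. -/
def HasW11Deriv {X : Type*} [NormedAddCommGroup X] [NormedSpace ℝ X]
    (T : ℝ) (x v : ℝ → X) : Prop :=
  IntegrableOn v (Set.Icc 0 T) volume ∧
    ∀ t ∈ Set.Icc 0 T, x t = x 0 + ∫ s in (0 : ℝ)..t, v s

/-- A partition `0 = t₀ < t₁ < ⋯ < t_m = T`; the values `t k` with `k > m` play no role. -/
structure TimePartition (T : ℝ) where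
  /-- the number of cells -/
  m : ℕ
  /-- the nodes -/
  t : ℕ → ℝ
  t_zero : t 0 = 0
  t_last : t m = T
  t_lt : ∀ k < m, t k < t (k + 1)

/-- The mesh size `max_k (t_k - t_{k-1})`. -/
noncomputable def TimePartition.mesh {T : ℝ} (P : TimePartition T) : ℝ :=
  ⨆ k : Fin P.m, (P.t (k + 1) - P.t k)

/-- The step function that is `v 0` at `t = 0` and `v k` on `(t_{k-1}, t_k]`, `k = 1, …, m`. -/
noncomputable def TimePartition.step {T : ℝ} {X : Type*} (P : TimePartition T) (v : ℕ → X)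
    (t : ℝ) : X :=
  v (sInf {k | t ≤ P.t k})

theorem TimePartition.step_zero {T : ℝ} {X : Type*} (P : TimePartition T) (v : ℕ → X) :
    P.step v 0 = v 0 := by
  have h : sInf {k | (0 : ℝ) ≤ P.t k} = 0 :=
    Nat.sInf_eq_zero.2 (Or.inl (by simp [P.t_zero]))
  simp [TimePartition.step, h]

theorem TimePartition.t_mono {T : ℝ} (P : TimePartition T) {j k : ℕ} (hjk : j ≤ k)
    (hk : k ≤ P.m) : P.t j ≤ P.t k := by
  induction k, hjk using Nat.le_induction with
  | base => exact le_rfl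
  | succ k _ ih => exact (ih (by omega)).trans (P.t_lt k (by omega)).le

theorem TimePartition.step_succ {T : ℝ} {X : Type*} (P : TimePartition T) (v : ℕ → X)
    {k : ℕ} (hk : k < P.m) {t : ℝ} (ht : t ∈ Set.Ioc (P.t k) (P.t (k + 1))) :
    P.step v t = v (k + 1) := by
  have h : sInf {j | t ≤ P.t j} = k + 1 := by
    refine le_antisymm (Nat.sInf_le ht.2) ?_
    by_contra hlt
    have hmem : t ≤ P.t (sInf {j | t ≤ P.t j}) :=
      Nat.sInf_mem (s := {j | t ≤ P.t j}) ⟨k + 1, ht.2⟩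
    exact absurd (hmem.trans (P.t_mono (by omega) hk.le)) (not_le.2 ht.1)
  simp [TimePartition.step, h]

/-! ## Solutions of non-autonomous problems -/

section Solutions

variable {X : Type*} [NormedAddCommGroup X] [InnerProductSpace ℝ X]

/-- Strong solution of `ẋ(t) ∈ -A_t(x(t))`, `x(0) = x₀`. -/
def IsStrongSolution (T : ℝ) (A : ℝ → Set (X × X)) (x₀ : X) (x : ℝ → X) : Prop :=
  ∃ v : ℝ → X, HasW11Deriv T x v ∧ x 0 = x₀ ∧ x₀ ∈ closure (relDom (A 0)) ∧
    ∀ᵐ t ∂(volume.restrict (Set.Icc 0 T)), ∃ y ∈ relImage (A t) (x t), v t = -y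

/-- The implicit scheme
`(x_k - x_{k-1}) / (t_k - t_{k-1}) ∈ -A_{t_k}(x_k) + g_k`, `k = 1, …, m`, with initial
value `x₀`. -/
def IsImplicitScheme {T : ℝ} (A : ℝ → Set (X × X)) (P : TimePartition T) (g : ℕ → X)
    (x₀ : X) (ξ : ℕ → X) : Prop :=
  ξ 0 = x₀ ∧ ∀ k < P.m, ∃ y ∈ relImage (A (P.t (k + 1))) (ξ (k + 1)),
    (P.t (k + 1) - P.t k)⁻¹ • (ξ (k + 1) - ξ k) = -y + g (k + 1)

/-- `x ∈ C([0,T],X)` is the uniform limit of step functions built, along the given sequence of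
partitions with mesh size tending to zero, from solutions of the implicit scheme with
coefficients `g n k`. -/
def IsSchemeLimit (T : ℝ) (A : ℝ → Set (X × X)) (P : ℕ → TimePartition T) (g : ℕ → ℕ → X)
    (x₀ : X) (x : ℝ → X) : Prop :=
  ContinuousOn x (Set.Icc 0 T) ∧ Tendsto (fun n => (P n).mesh) atTop (𝓝 0) ∧
    ∃ ξ : ℕ → ℕ → X, (∀ n, IsImplicitScheme A (P n) (g n) x₀ (ξ n)) ∧
      TendstoUniformlyOn (fun n => (P n).step (ξ n)) x atTop (Set.Icc 0 T)

/-- The step functions with coefficients `g n k` converge to `f` in `L¹([0,T],X)`. -/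
def StepsTendstoL1 (T : ℝ) (P : ℕ → TimePartition T) (g : ℕ → ℕ → X) (f : ℝ → X) : Prop :=
  Tendsto (fun n => eLpNorm (fun t => (P n).step (g n) t - f t) 1
    (volume.restrict (Set.Icc 0 T))) atTop (𝓝 0)

/-- Generalized solution of `ẋ(t) ∈ -A_t(x(t))`, `x(0) = x₀`: a uniform limit of solutions of
the implicit scheme without any inhomogeneity. -/
def IsGeneralizedSolution (T : ℝ) (A : ℝ → Set (X × X)) (x₀ : X) (x : ℝ → X) : Prop :=
  ∃ P : ℕ → TimePartition T, IsSchemeLimit T A P (fun _ _ => 0) x₀ x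

/-- Generalized solution of the inhomogeneous problem `ẋ(t) ∈ -A_t(x(t)) + f(t)`,
`x(0) = x₀`, where `f` is only defined up to null sets: a uniform limit of solutions of the
implicit scheme with inhomogeneities `f_k^n` whose step functions tend to `f` in `L¹`. -/
def IsGeneralizedSolutionInhom (T : ℝ) (A : ℝ → Set (X × X)) (f : ℝ → X) (x₀ : X)
    (x : ℝ → X) : Prop :=
  ∃ (P : ℕ → TimePartition T) (g : ℕ → ℕ → X),
    StepsTendstoL1 T P g f ∧ IsSchemeLimit T A P g x₀ x

end Solutions

/-! ## Boundary control systems and the lifting -/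

section Lifting

variable {X : Type*} [NormedAddCommGroup X] [InnerProductSpace ℝ X] {m : ℕ}

/-- The operators `A_t = {(x, w) ∈ 𝔄 | 𝔭 x = u(t)}`: the boundary control system
`ẋ ∈ -𝔄 x`, `𝔭 x = u` is the problem `ẋ(t) ∈ -A_t(x(t))`. -/
def boundaryOp (𝔄 : Set (X × X)) (p : X →ₗ.[ℝ] EuclideanSpace ℝ (Fin m))
    (u : ℝ → EuclideanSpace ℝ (Fin m)) (t : ℝ) : Set (X × X) :=
  {q | q ∈ 𝔄 ∧ ∃ h : q.1 ∈ p.domain, p ⟨q.1, h⟩ = u t}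

/-- The kernel of `𝔭`, as a subset of `X`. -/
def kerSet (p : X →ₗ.[ℝ] EuclideanSpace ℝ (Fin m)) : Set X :=
  {z | ∃ h : z ∈ p.domain, p ⟨z, h⟩ = 0}

/-- The combination `t ↦ ∑ i, w_i(t) b_i`. For `w = u` this is the lifting `x̃`, for `w = u̇` it
is the derivative of the lifting. -/
def lift (b : Fin m → X) (w : ℝ → EuclideanSpace ℝ (Fin m)) (t : ℝ) : X :=
  ∑ i, w t i • b i

/-- The operators `z ↦ 𝔄(z + x̃(t))` on `ker 𝔭`. -/
def shiftedOp (𝔄 : Set (X × X)) (p : X →ₗ.[ℝ] EuclideanSpace ℝ (Fin m)) (xl : ℝ → X)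
    (t : ℝ) : Set (X × X) :=
  {q | q.1 ∈ kerSet p ∧ q.2 ∈ relImage 𝔄 (q.1 + xl t)}

/-- The operators `𝒜_t(z) = 𝔄(z + x̃(t)) + x̃'(t)` on `ker 𝔭`. -/
def liftedOp (𝔄 : Set (X × X)) (p : X →ₗ.[ℝ] EuclideanSpace ℝ (Fin m)) (xl dxl : ℝ → X)
    (t : ℝ) : Set (X × X) :=
  {q | ∃ y ∈ relImage (shiftedOp 𝔄 p xl t) q.1, q.2 = y + dxl t}

end Lifting

end BoundaryLifting

/-!
The translation `z = x - x̃` turns the implicit scheme for `A_t` with inhomogeneities `g_k` into the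
scheme for the shifted operators with inhomogeneities `g_k - (x̃(t_k) - x̃(t_{k-1})) / (t_k -
t_{k-1})` (`IsLifting.isImplicitScheme_iff`), and step functions of the nodal values of `x̃` converge
uniformly to `x̃` when the mesh size tends to zero (`tendstoUniformlyOn_step_comp`). Uniform limits of
the two schemes thus correspond to each other (`IsLifting.isSchemeLimit_iff`). The difference
quotients of `x̃` are the means of its derivative over the cells, so they converge to that derivative
in `L¹` (`HasW11Deriv.stepsTendstoL1_diffQuot`). This settles generalized solutions as long as
inhomogeneities that vanish in the limit are allowed in both schemes.

Such inhomogeneities can be dropped when the operators `A_t` are maximal monotone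
(`IsSchemeLimit.congr_inhom`). The scheme is then solvable for all inhomogeneities by Minty's theorem
(`IsMaximalMonotoneRel.exists_add_smul_eq`), and its solutions depend on them in a Lipschitz way, from
`L¹` to the uniform norm, because resolvents are contractions (`IsImplicitScheme.norm_sub_le`).
Minty's theorem is proved by minimizing the sum of the Fitzpatrick function and half the squared
norm. That sum is strongly convex, so no weak compactness is needed.
-/

namespace BoundaryLifting

/-! ### Maximal monotone operators and Minty's theorem -/

section Minty

variable {X : Type*} [NormedAddCommGroup X] [InnerProductSpace ℝ X]

theorem IsMaximalMonotoneRel.mem_of_forall {A : Set (X × X)} (hA : IsMaximalMonotoneRel A)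
    {q : X × X} (hq : ∀ a ∈ A, 0 ≤ inner ℝ (q.1 - a.1) (q.2 - a.2)) : q ∈ A := by
  have hB : IsMonotoneRel (insert q A) := by
    rintro a (rfl | ha) c (rfl | hc)
    · simp
    · exact hq c hc
    · have := hq a ha
      rwa [← neg_sub c.1 a.1, ← neg_sub c.2 a.2, inner_neg_neg]
    · exact hA.1 a ha c hc
  rw [← hA.2 _ hB (Set.subset_insert q A)]
  exact Set.mem_insert q A

/-- The epigraph of the Fitzpatrick function
`(x, w) ↦ sup {⟪x, b⟫ + ⟪a, w⟫ - ⟪a, b⟫ | (a, b) ∈ A}`, as a set of triples `(x, w, c)`. The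
epigraph takes the place of the function itself, which may be infinite. -/
def fitzpatrickEpi (A : Set (X × X)) : Set (X × X × ℝ) :=
  {e | ∀ a ∈ A, inner ℝ e.1 a.2 + inner ℝ a.1 e.2.1 - inner ℝ a.1 a.2 ≤ e.2.2}

theorem isClosed_fitzpatrickEpi (A : Set (X × X)) : IsClosed (fitzpatrickEpi A) := by
  simp only [fitzpatrickEpi, Set.ofPred_forall]
  refine isClosed_iInter fun a => isClosed_iInter fun _ => isClosed_le ?_ ?_ <;> fun_prop

theorem convex_fitzpatrickEpi (A : Set (X × X)) : Convex ℝ (fitzpatrickEpi A) := by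
  intro e he f hf s t hs ht hst a ha
  have h1 := mul_le_mul_of_nonneg_left (he a ha) hs
  have h2 := mul_le_mul_of_nonneg_left (hf a ha) ht
  simp only [Prod.fst_add, Prod.snd_add, Prod.smul_fst, Prod.smul_snd, inner_add_left,
    inner_add_right, real_inner_smul_left, real_inner_smul_right, smul_eq_mul]
  linear_combination h1 + h2 + inner ℝ a.1 a.2 * hst

theorem IsMonotoneRel.mem_fitzpatrickEpi {A : Set (X × X)} (hA : IsMonotoneRel A) {a : X × X}
    (ha : a ∈ A) : (a.1, a.2, inner ℝ a.1 a.2) ∈ fitzpatrickEpi A := by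
  intro c hc
  have := hA a ha c hc
  simp only [inner_sub_left, inner_sub_right] at this
  linarith

/-- The Fitzpatrick function of a maximal monotone operator dominates the duality pairing. -/
theorem IsMaximalMonotoneRel.inner_le_of_mem_fitzpatrickEpi {A : Set (X × X)}
    (hA : IsMaximalMonotoneRel A) {e : X × X × ℝ} (he : e ∈ fitzpatrickEpi A) :
    inner ℝ e.1 e.2.1 ≤ e.2.2 := by
  by_cases h : (e.1, e.2.1) ∈ A
  · have := he _ h
    simpa using this
  · have : ¬ ∀ a ∈ A, 0 ≤ inner ℝ (e.1 - a.1) (e.2.1 - a.2) := fun hq => h (hA.mem_of_forall hq)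
    push Not at this
    obtain ⟨a, ha, hlt⟩ := this
    have := he a ha
    simp only [inner_sub_left, inner_sub_right] at hlt
    linarith

theorem IsMaximalMonotoneRel.nonempty {A : Set (X × X)} (hA : IsMaximalMonotoneRel A) :
    A.Nonempty := by
  by_contra h
  rw [Set.not_nonempty_iff_eq_empty] at h
  have : (0 : X × X) ∈ A := hA.mem_of_forall (by simp [h])
  simp [h] at this

/-- Completeness enters here: the strongly convex functional `c + ‖x‖² / 2 + ‖w‖² / 2` attains
its minimum on a closed convex set on which it is bounded below, because minimizing sequences are
Cauchy. -/
theorem exists_isMinOn_add_sq [CompleteSpace X] {E : Set (X × X × ℝ)} (hE : IsClosed E)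
    (hconv : Convex ℝ E) (hne : E.Nonempty)
    (hbd : ∀ e ∈ E, 0 ≤ e.2.2 + ‖e.1‖ ^ 2 / 2 + ‖e.2.1‖ ^ 2 / 2) :
    ∃ e ∈ E, ∀ f ∈ E, e.2.2 + ‖e.1‖ ^ 2 / 2 + ‖e.2.1‖ ^ 2 / 2 ≤
      f.2.2 + ‖f.1‖ ^ 2 / 2 + ‖f.2.1‖ ^ 2 / 2 := by
  set J : X × X × ℝ → ℝ := fun e => e.2.2 + ‖e.1‖ ^ 2 / 2 + ‖e.2.1‖ ^ 2 / 2 with hJ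
  have hJc : Continuous J := by fun_prop
  have hbdd : BddBelow (J '' E) := ⟨0, by rintro _ ⟨e, he, rfl⟩; exact hbd e he⟩
  set μ := sInf (J '' E) with hμ
  have hle : ∀ e ∈ E, μ ≤ J e := fun e he => csInf_le hbdd ⟨e, he, rfl⟩
  have hseq : ∀ n : ℕ, ∃ e ∈ E, J e < μ + 1 / ((n : ℝ) + 1) := by
    intro n
    obtain ⟨_, ⟨e, he, rfl⟩, h⟩ := exists_lt_of_csInf_lt (hne.image J)
      (show sInf (J '' E) < μ + 1 / ((n : ℝ) + 1) by
        rw [← hμ]; linarith [Nat.one_div_pos_of_nat (α := ℝ) (n := n)])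
    exact ⟨e, he, h⟩
  choose e heE heJ using hseq
  -- The parallelogram law bounds the distance of two almost minimizers.
  have hpar : ∀ f ∈ E, ∀ g ∈ E, ∀ δ, J f ≤ μ + δ → J g ≤ μ + δ →
      ‖f.1 - g.1‖ ^ 2 + ‖f.2.1 - g.2.1‖ ^ 2 ≤ 8 * δ := by
    intro f hf g hg δ hfδ hgδ
    have hm := hle _ (hconv hf hg (by norm_num : (0 : ℝ) ≤ 1 / 2) (by norm_num : (0 : ℝ) ≤ 1 / 2)
      (by norm_num))
    simp only [hJ, Prod.fst_add, Prod.snd_add, Prod.smul_fst, Prod.smul_snd, smul_eq_mul] at hm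
    rw [← smul_add, ← smul_add, norm_smul, norm_smul] at hm
    norm_num at hm
    have p1 := parallelogram_law_with_norm ℝ f.1 g.1
    have p2 := parallelogram_law_with_norm ℝ f.2.1 g.2.1
    simp only [hJ] at hfδ hgδ
    nlinarith
  have h0 : Tendsto (fun n : ℕ => √(8 * (1 / ((n : ℝ) + 1)))) atTop (𝓝 0) := by
    have := (tendsto_one_div_add_atTop_nhds_zero_nat (𝕜 := ℝ)).const_mul 8
    simpa using this.sqrt
  have hmono : ∀ N n : ℕ, N ≤ n → J (e n) ≤ μ + 1 / ((N : ℝ) + 1) := fun N n h =>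
    (heJ n).le.trans (by gcongr)
  have hc1 : CauchySeq fun n => (e n).1 := by
    refine cauchySeq_of_le_tendsto_0 _ (fun n k N hn hk => ?_) h0
    rw [dist_eq_norm]
    refine Real.le_sqrt_of_sq_le ?_
    have := hpar _ (heE n) _ (heE k) _ (hmono N n hn) (hmono N k hk)
    nlinarith [sq_nonneg ‖(e n).2.1 - (e k).2.1‖]
  have hc2 : CauchySeq fun n => (e n).2.1 := by
    refine cauchySeq_of_le_tendsto_0 _ (fun n k N hn hk => ?_) h0
    rw [dist_eq_norm]
    refine Real.le_sqrt_of_sq_le ?_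
    have := hpar _ (heE n) _ (heE k) _ (hmono N n hn) (hmono N k hk)
    nlinarith [sq_nonneg ‖(e n).1 - (e k).1‖]
  obtain ⟨x, hx⟩ := cauchySeq_tendsto_of_complete hc1
  obtain ⟨w, hw⟩ := cauchySeq_tendsto_of_complete hc2
  have hJlim : Tendsto (fun n => J (e n)) atTop (𝓝 μ) := by
    refine tendsto_of_tendsto_of_tendsto_of_le_of_le tendsto_const_nhds
      (?_ : Tendsto (fun n : ℕ => μ + 1 / ((n : ℝ) + 1)) atTop (𝓝 μ))
      (fun n => hle _ (heE n)) (fun n => (heJ n).le)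
    simpa using (tendsto_one_div_add_atTop_nhds_zero_nat (𝕜 := ℝ)).const_add μ
  have hc : Tendsto (fun n => (e n).2.2) atTop (𝓝 (μ - ‖x‖ ^ 2 / 2 - ‖w‖ ^ 2 / 2)) := by
    refine ((hJlim.sub ((hx.norm.pow 2).div_const 2)).sub ((hw.norm.pow 2).div_const 2)).congr ?_
    intro n
    simp only [hJ]
    ring
  refine ⟨(x, w, μ - ‖x‖ ^ 2 / 2 - ‖w‖ ^ 2 / 2),
    hE.mem_of_tendsto (hx.prodMk_nhds (hw.prodMk_nhds hc)) (Eventually.of_forall heE), ?_⟩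
  intro f hf
  have := hle f hf
  simp only [hJ] at this
  linarith

/-- Minty's theorem at the origin: `0 ∈ x + A x` for some `x`. The minimizer `(x, w, c)` of
`c + ‖x‖² / 2 + ‖w‖² / 2` over the epigraph of the Fitzpatrick function satisfies
`⟪a + w, b + x⟫ ≥ ‖x + w‖²` for all `(a, b) ∈ A`, which puts `(-w, -x)` into `A` and forces
`w = -x`. -/
theorem IsMaximalMonotoneRel.exists_neg_mem [CompleteSpace X] {A : Set (X × X)}
    (hA : IsMaximalMonotoneRel A) : ∃ x, (x, -x) ∈ A := by
  obtain ⟨a₀, ha₀⟩ := hA.nonempty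
  obtain ⟨⟨x, w, c⟩, he, hmin⟩ := exists_isMinOn_add_sq (isClosed_fitzpatrickEpi A)
    (convex_fitzpatrickEpi A) ⟨_, hA.1.mem_fitzpatrickEpi ha₀⟩ (fun e he => by
      have h1 := hA.inner_le_of_mem_fitzpatrickEpi he
      have h2 := norm_add_sq_real e.1 e.2.1
      nlinarith [sq_nonneg ‖e.1 + e.2.1‖])
  have hxw : inner ℝ x w ≤ c := hA.inner_le_of_mem_fitzpatrickEpi he
  have key : ∀ a ∈ A, ‖x + w‖ ^ 2 ≤ inner ℝ (a.1 + w) (a.2 + x) := by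
    intro a ha
    -- First-order optimality: compare with the points of the segment towards `(a, b, ⟪a, b⟫)`.
    have hs : ∀ s ∈ Set.Ioc (0 : ℝ) 1, 0 ≤ (inner ℝ a.1 a.2 - c + inner ℝ x (a.1 - x) +
        inner ℝ w (a.2 - w)) + s * ((‖a.1 - x‖ ^ 2 + ‖a.2 - w‖ ^ 2) / 2) := by
      intro s hs
      have hseg := hmin _ ((convex_fitzpatrickEpi A).add_smul_sub_mem he
        (hA.1.mem_fitzpatrickEpi ha) ⟨hs.1.le, hs.2⟩)
      simp only [Prod.fst_add, Prod.snd_add, Prod.smul_fst, Prod.smul_snd, Prod.fst_sub,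
        Prod.snd_sub, smul_eq_mul, norm_add_sq_real, norm_smul, real_inner_smul_right, mul_pow,
        Real.norm_eq_abs, sq_abs] at hseg
      refine nonneg_of_mul_nonneg_right (?_ : 0 ≤ s * _) hs.1
      nlinarith
    have hlim : 0 ≤ (inner ℝ a.1 a.2 - c + inner ℝ x (a.1 - x) + inner ℝ w (a.2 - w)) +
        0 * ((‖a.1 - x‖ ^ 2 + ‖a.2 - w‖ ^ 2) / 2) := by
      refine ge_of_tendsto (Continuous.tendsto' (f := fun s : ℝ => (inner ℝ a.1 a.2 - c +
        inner ℝ x (a.1 - x) + inner ℝ w (a.2 - w)) + s * ((‖a.1 - x‖ ^ 2 + ‖a.2 - w‖ ^ 2) / 2))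
        (by fun_prop) 0 _ rfl |>.mono_left (nhdsWithin_le_nhds (s := Set.Ioi 0))) ?_
      filter_upwards [Ioc_mem_nhdsGT (zero_lt_one' ℝ)] with s h using hs s h
    rw [norm_add_sq_real]
    simp only [inner_add_left, inner_add_right, inner_sub_right, real_inner_self_eq_norm_sq]
      at hlim ⊢
    rw [real_inner_comm x w, real_inner_comm x a.1] at *
    linarith
  have hmem : (-w, -x) ∈ A := hA.mem_of_forall fun a ha => by
    have := (sq_nonneg _).trans (key a ha)
    rw [← neg_add', ← neg_add', inner_neg_neg]
    simpa [add_comm] using this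
  have h0 := key _ hmem
  simp only [neg_add_cancel, inner_zero_left] at h0
  have hw : x = -w := eq_neg_of_add_eq_zero_left
    (norm_eq_zero.1 (pow_eq_zero_iff two_ne_zero |>.1 (le_antisymm h0 (sq_nonneg _))))
  exact ⟨x, by rwa [← hw] at hmem⟩

/-- Minty's theorem: the resolvents of a maximal monotone operator are everywhere defined. -/
theorem IsMaximalMonotoneRel.exists_add_smul_eq [CompleteSpace X] {A : Set (X × X)}
    (hA : IsMaximalMonotoneRel A) {h : ℝ} (hh : 0 < h) (y : X) :
    ∃ q ∈ A, q.1 + h • q.2 = y := by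
  have hB : IsMaximalMonotoneRel {q : X × X | (q.1, h⁻¹ • (q.2 + y)) ∈ A} := by
    have hsub : ∀ a c : X × X, inner ℝ (a.1 - c.1) (h⁻¹ • (a.2 + y) - h⁻¹ • (c.2 + y)) =
        h⁻¹ * inner ℝ (a.1 - c.1) (a.2 - c.2) := by
      intro a c
      rw [← smul_sub, add_sub_add_right_eq_sub, real_inner_smul_right]
    refine ⟨fun a ha c hc => ?_, fun B hB hle => (hle.antisymm fun q hq => ?_).symm⟩
    · have := hA.1 _ ha _ hc
      simp only [hsub] at this
      exact nonneg_of_mul_nonneg_right this (inv_pos.2 hh)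
    · refine hA.mem_of_forall fun a ha => ?_
      have ha' : (a.1, h • a.2 - y) ∈ B := hle (by
        simpa only [Set.mem_ofPred_eq, sub_add_cancel, inv_smul_smul₀ hh.ne'] using ha)
      have := mul_nonneg (inv_pos.2 hh).le (hB q hq _ ha')
      rw [← hsub] at this
      simpa [smul_smul, hh.ne'] using this
  obtain ⟨x, hx⟩ := hB.exists_neg_mem
  exact ⟨_, hx, by simp [smul_smul, hh.ne']⟩

end Minty

/-! ### Partitions and step functions -/

namespace TimePartition

variable {T : ℝ} (P : TimePartition T)

theorem t_mem_Icc {k : ℕ} (hk : k ≤ P.m) : P.t k ∈ Set.Icc 0 T :=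
  ⟨P.t_zero.symm.trans_le (P.t_mono k.zero_le hk), (P.t_mono hk le_rfl).trans_eq P.t_last⟩

theorem sub_le_mesh {k : ℕ} (hk : k < P.m) : P.t (k + 1) - P.t k ≤ P.mesh :=
  le_ciSup (f := fun k : Fin P.m => P.t (k + 1) - P.t k) (Set.finite_range _).bddAbove ⟨k, hk⟩

theorem mesh_nonneg : 0 ≤ P.mesh :=
  Real.iSup_nonneg fun k => sub_nonneg.2 (P.t_lt k k.2).le

/-- The index whose value the step functions take at `t`. -/
noncomputable def idx (t : ℝ) : ℕ := sInf {k | t ≤ P.t k}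

theorem step_eq {X : Type*} (v : ℕ → X) (t : ℝ) : P.step v t = v (P.idx t) := rfl

theorem idx_le {t : ℝ} (ht : t ∈ Set.Icc 0 T) : P.idx t ≤ P.m :=
  Nat.sInf_le (ht.2.trans_eq P.t_last.symm)

theorem le_t_idx {t : ℝ} (ht : t ∈ Set.Icc 0 T) : t ≤ P.t (P.idx t) :=
  Nat.sInf_mem (s := {k | t ≤ P.t k}) ⟨P.m, ht.2.trans_eq P.t_last.symm⟩

theorem abs_t_idx_sub_le_mesh {t : ℝ} (ht : t ∈ Set.Icc 0 T) :
    |P.t (P.idx t) - t| ≤ P.mesh := by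
  rw [abs_of_nonneg (sub_nonneg.2 (P.le_t_idx ht))]
  rcases hk : P.idx t with _ | k
  · have := P.mesh_nonneg
    rw [P.t_zero]
    linarith [ht.1]
  · have hlt : P.t k < t := not_le.1 (Nat.notMem_of_lt_sInf (s := {k | t ≤ P.t k})
      (show k < P.idx t by omega))
    have := P.sub_le_mesh (k := k) (by have := P.idx_le ht; omega)
    linarith

theorem measurable_idx : Measurable P.idx := by
  refine measurable_to_countable' fun k => ?_
  have h : P.idx ⁻¹' {k} = ({t | t ≤ P.t k} ∩ ⋂ j ∈ Set.Iio k, {t | P.t j < t}) ∪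
      ({_t : ℝ | k = 0} ∩ ⋂ j, {t | P.t j < t}) := by
    ext t
    simp only [Set.mem_preimage, Set.mem_singleton_iff, Set.mem_union, Set.mem_inter_iff,
      Set.mem_ofPred_eq, Set.mem_iInter, Set.mem_Iio]
    constructor
    · rintro rfl
      rcases Set.eq_empty_or_nonempty {j | t ≤ P.t j} with he | hne
      · refine Or.inr ⟨by simp [idx, he], fun j => not_le.1 fun hj => ?_⟩
        exact Set.notMem_empty j (he ▸ hj)
      · exact Or.inl ⟨Nat.sInf_mem hne, fun j hj => not_le.1 (Nat.notMem_of_lt_sInf hj)⟩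
    · rintro (⟨h1, h2⟩ | ⟨rfl, h⟩)
      · refine le_antisymm (Nat.sInf_le h1) (not_lt.1 fun hlt => ?_)
        exact (h2 _ hlt).not_ge (Nat.sInf_mem (s := {j | t ≤ P.t j}) ⟨k, h1⟩)
      · exact Nat.sInf_eq_zero.2 (Or.inr (Set.eq_empty_of_forall_notMem fun j => (h j).not_ge))
  rw [h]
  refine ((measurableSet_Iic (a := P.t k)).inter ?_).union ((MeasurableSet.const _).inter ?_)
  · exact MeasurableSet.biInter (Set.to_countable _) fun j _ => measurableSet_Ioi
  · exact MeasurableSet.iInter fun j => measurableSet_Ioi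

theorem stronglyMeasurable_step {X : Type*} [TopologicalSpace X] (v : ℕ → X) :
    StronglyMeasurable (P.step v) :=
  StronglyMeasurable.of_discrete.comp_measurable P.measurable_idx

/-- Integration over `[0,T]` cell by cell. The point `0`, which belongs to no cell, is a null
set. -/
theorem lintegral_eq_sum (F : ℝ → ENNReal) :
    ∫⁻ t in Set.Icc 0 T, F t =
      ∑ k ∈ Finset.range P.m, ∫⁻ t in Set.Ioc (P.t k) (P.t (k + 1)), F t := by
  have h : ∀ n ≤ P.m, ∫⁻ t in Set.Ioc 0 (P.t n), F t =
      ∑ k ∈ Finset.range n, ∫⁻ t in Set.Ioc (P.t k) (P.t (k + 1)), F t := by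
    intro n
    induction n with
    | zero => simp [P.t_zero]
    | succ n ih =>
      intro hn
      rw [Finset.sum_range_succ, ← ih (by omega), ← lintegral_union measurableSet_Ioc,
        Set.Ioc_union_Ioc_eq_Ioc (P.t_mem_Icc (by omega)).1 (P.t_lt n hn).le]
      exact Set.disjoint_left.2 fun t h1 h2 => h1.2.not_gt h2.1
  rw [← restrict_Ioc_eq_restrict_Icc, ← h _ le_rfl, P.t_last]

theorem lintegral_comp_step {X : Type*} (F : X → ENNReal) (v : ℕ → X) :
    ∫⁻ t in Set.Icc 0 T, F (P.step v t) =
      ∑ k ∈ Finset.range P.m, F (v (k + 1)) * ENNReal.ofReal (P.t (k + 1) - P.t k) := by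
  rw [P.lintegral_eq_sum]
  refine Finset.sum_congr rfl fun k hk => ?_
  rw [setLIntegral_congr_fun (g := fun _ => F (v (k + 1))) measurableSet_Ioc fun t ht => by
    simp only [P.step_succ v (Finset.mem_range.1 hk) ht], setLIntegral_const, Real.volume_Ioc]

variable {X : Type*} [NormedAddCommGroup X]

theorem ofReal_sum_mul_norm (v : ℕ → X) :
    ENNReal.ofReal (∑ k ∈ Finset.range P.m, (P.t (k + 1) - P.t k) * ‖v (k + 1)‖) =
      ∫⁻ t in Set.Icc 0 T, ‖P.step v t‖ₑ := by
  have h : ∀ k ∈ Finset.range P.m, 0 ≤ P.t (k + 1) - P.t k := fun k hk =>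
    sub_nonneg.2 (P.t_lt k (Finset.mem_range.1 hk)).le
  rw [P.lintegral_comp_step (fun y => ‖y‖ₑ),
    ENNReal.ofReal_sum_of_nonneg fun k hk => mul_nonneg (h k hk) (norm_nonneg _)]
  refine Finset.sum_congr rfl fun k hk => ?_
  rw [ENNReal.ofReal_mul (h k hk), ofReal_norm, mul_comm]

variable [NormedSpace ℝ X]

/-- The backward difference quotients of `x` at the nodes, `(x(t_k) - x(t_{k-1})) / (t_k -
t_{k-1})` for `k = 1, …, m`. The value at `k = 0` is `0`. -/
noncomputable def diffQuot (x : ℝ → X) (k : ℕ) : X :=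
  (P.t k - P.t (k - 1))⁻¹ • (x (P.t k) - x (P.t (k - 1)))

theorem diffQuot_succ (x : ℝ → X) (k : ℕ) :
    P.diffQuot x (k + 1) = (P.t (k + 1) - P.t k)⁻¹ • (x (P.t (k + 1)) - x (P.t k)) := rfl

end TimePartition

/-! ### Convergence of step functions -/

section StepFunctions

variable {T : ℝ}

/-- Step functions of nodal values of a continuous function converge uniformly. -/
theorem tendstoUniformlyOn_step_comp {X : Type*} [NormedAddCommGroup X]
    {P : ℕ → TimePartition T} (hP : Tendsto (fun n => (P n).mesh) atTop (𝓝 0)) {x : ℝ → X}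
    (hx : ContinuousOn x (Set.Icc 0 T)) :
    TendstoUniformlyOn (fun n => (P n).step fun k => x ((P n).t k)) x atTop (Set.Icc 0 T) := by
  rw [Metric.tendstoUniformlyOn_iff]
  intro ε hε
  obtain ⟨δ, hδ, h⟩ := Metric.uniformContinuousOn_iff.1
    (isCompact_Icc.uniformContinuousOn_of_continuous hx) ε hε
  filter_upwards [hP.eventually_lt_const hδ] with n hn t ht
  rw [TimePartition.step_eq]
  refine h t ht _ ((P n).t_mem_Icc ((P n).idx_le ht)) ?_
  rw [dist_comm, Real.dist_eq]
  exact ((P n).abs_t_idx_sub_le_mesh ht).trans_lt hn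

theorem stepsTendstoL1_iff {X : Type*} [NormedAddCommGroup X] {P : ℕ → TimePartition T}
    {g : ℕ → ℕ → X} {f : ℝ → X} :
    StepsTendstoL1 T P g f ↔
      Tendsto (fun n => ∫⁻ t in Set.Icc 0 T, ‖(P n).step (g n) t - f t‖ₑ) atTop (𝓝 0) := by
  simp only [StepsTendstoL1, eLpNorm_one_eq_lintegral_enorm]

theorem StepsTendstoL1.sub {X : Type*} [NormedAddCommGroup X] {P : ℕ → TimePartition T}
    {g g' : ℕ → ℕ → X} {f f' : ℝ → X} (h : StepsTendstoL1 T P g f)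
    (h' : StepsTendstoL1 T P g' f')
    (hf : AEStronglyMeasurable f (volume.restrict (Set.Icc 0 T)))
    (hf' : AEStronglyMeasurable f' (volume.restrict (Set.Icc 0 T))) :
    StepsTendstoL1 T P (fun n k => g n k - g' n k) (fun t => f t - f' t) := by
  have hsum := Tendsto.add h h'
  rw [add_zero] at hsum
  refine tendsto_of_tendsto_of_tendsto_of_le_of_le tendsto_const_nhds hsum (fun _ => zero_le)
    fun n => ?_
  refine le_trans (le_of_eq ?_) (eLpNorm_sub_le
    ((((P n).stronglyMeasurable_step (g n)).aestronglyMeasurable).sub hf)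
    ((((P n).stronglyMeasurable_step (g' n)).aestronglyMeasurable).sub hf') le_rfl)
  congr 1
  ext t
  simp only [TimePartition.step_eq, Pi.sub_apply]
  abel

theorem stepsTendstoL1_zero {X : Type*} [NormedAddCommGroup X] (P : ℕ → TimePartition T) :
    StepsTendstoL1 T P (fun _ _ => (0 : X)) fun _ => 0 := by
  simp [StepsTendstoL1, TimePartition.step_eq]

end StepFunctions

/-! ### Functions of class `W^{1,1}` and their difference quotients -/

section W11

variable {X : Type*} [NormedAddCommGroup X] [NormedSpace ℝ X] {T : ℝ} {x v : ℝ → X}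

theorem HasW11Deriv.intervalIntegrable (h : HasW11Deriv T x v) {a c : ℝ}
    (ha : a ∈ Set.Icc 0 T) (hc : c ∈ Set.Icc 0 T) : IntervalIntegrable v volume a c :=
  (h.1.mono_set (Set.uIcc_subset_Icc ha hc)).intervalIntegrable

theorem HasW11Deriv.sub_eq_integral (h : HasW11Deriv T x v) {a c : ℝ}
    (ha : a ∈ Set.Icc 0 T) (hc : c ∈ Set.Icc 0 T) : x c - x a = ∫ s in a..c, v s := by
  have h0 : (0 : ℝ) ∈ Set.Icc 0 T := ⟨le_rfl, ha.1.trans ha.2⟩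
  rw [h.2 c hc, h.2 a ha, add_sub_add_left_eq_sub, intervalIntegral.integral_interval_sub_left
    (h.intervalIntegrable h0 hc) (h.intervalIntegrable h0 ha)]

theorem HasW11Deriv.continuousOn (hT : 0 ≤ T) (h : HasW11Deriv T x v) :
    ContinuousOn x (Set.Icc 0 T) := by
  have := intervalIntegral.continuousOn_primitive_interval' (a := 0)
    (h.intervalIntegrable ⟨le_rfl, hT⟩ ⟨hT, le_rfl⟩) (by simp)
  rw [Set.uIcc_of_le hT] at this
  exact (continuousOn_const.add this).congr h.2

theorem HasW11Deriv.add {y w : ℝ → X} (hT : 0 ≤ T) (h : HasW11Deriv T x v)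
    (h' : HasW11Deriv T y w) : HasW11Deriv T (fun t => x t + y t) (fun t => v t + w t) := by
  refine ⟨h.1.add h'.1, fun t ht => ?_⟩
  have h0 : (0 : ℝ) ∈ Set.Icc 0 T := ⟨le_rfl, hT⟩
  rw [intervalIntegral.integral_add (h.intervalIntegrable h0 ht) (h'.intervalIntegrable h0 ht)]
  simp only [h.2 t ht, h'.2 t ht]
  abel

theorem HasW11Deriv.neg (h : HasW11Deriv T x v) :
    HasW11Deriv T (fun t => -x t) (fun t => -v t) := by
  refine ⟨h.1.neg, fun t ht => ?_⟩
  rw [intervalIntegral.integral_neg]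
  simp only [h.2 t ht]
  abel

theorem HasW11Deriv.clm_comp [CompleteSpace X] {Y : Type*} [NormedAddCommGroup Y]
    [NormedSpace ℝ Y] [CompleteSpace Y] (hT : 0 ≤ T) (h : HasW11Deriv T x v) (L : X →L[ℝ] Y) :
    HasW11Deriv T (fun t => L (x t)) (fun t => L (v t)) := by
  refine ⟨L.integrable_comp h.1, fun t ht => ?_⟩
  rw [L.intervalIntegral_comp_comm (h.intervalIntegrable ⟨le_rfl, hT⟩ ht), ← map_add, ← h.2 t ht]

/-- On each cell the difference quotient of `x` is the mean of `v`, hence at most as far from a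
constant in `L¹` as `v` itself. -/
theorem HasW11Deriv.lintegral_diffQuot_sub_step_le [CompleteSpace X] (h : HasW11Deriv T x v)
    (P : TimePartition T) (c : ℕ → X) :
    ∫⁻ t in Set.Icc 0 T, ‖P.step (fun k => P.diffQuot x k - c k) t‖ₑ ≤
      ∫⁻ t in Set.Icc 0 T, ‖v t - P.step c t‖ₑ := by
  rw [P.lintegral_comp_step (fun y => ‖y‖ₑ), P.lintegral_eq_sum]
  refine Finset.sum_le_sum fun k hk => ?_
  have hk := Finset.mem_range.1 hk
  have hlt := P.t_lt k hk
  have hpos : 0 < P.t (k + 1) - P.t k := sub_pos.2 hlt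
  have hint := h.intervalIntegrable (P.t_mem_Icc hk.le) (P.t_mem_Icc hk)
  have hcell : ∫ s in Set.Ioc (P.t k) (P.t (k + 1)), (v s - P.step c s) =
      (P.t (k + 1) - P.t k) • (P.diffQuot x (k + 1) - c (k + 1)) := by
    rw [setIntegral_congr_fun (g := fun s => v s - c (k + 1)) measurableSet_Ioc fun s hs => by
        simp only [P.step_succ c hk hs],
      ← intervalIntegral.integral_of_le hlt.le,
      intervalIntegral.integral_sub hint intervalIntegrable_const,
      ← h.sub_eq_integral (P.t_mem_Icc hk.le) (P.t_mem_Icc hk), intervalIntegral.integral_const,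
      smul_sub, P.diffQuot_succ, smul_inv_smul₀ hpos.ne']
  refine le_trans (le_of_eq ?_) (enorm_integral_le_lintegral_enorm _)
  rw [hcell, enorm_smul, Real.enorm_eq_ofReal hpos.le, mul_comm]

/-- The difference quotients of a `W^{1,1}` function converge to its derivative in `L¹`: compare
both with the step functions of nodal values of a continuous `L¹` approximation of the
derivative. -/
theorem HasW11Deriv.stepsTendstoL1_diffQuot [CompleteSpace X] (h : HasW11Deriv T x v)
    {P : ℕ → TimePartition T} (hP : Tendsto (fun n => (P n).mesh) atTop (𝓝 0)) :
    StepsTendstoL1 T P (fun n => (P n).diffQuot x) v := by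
  rw [stepsTendstoL1_iff, ENNReal.tendsto_nhds_zero]
  intro ε hε
  rcases eq_or_ne ε ⊤ with rfl | hε'
  · exact Eventually.of_forall fun n => le_top
  obtain ⟨g, -, hg, hgc, -⟩ := h.1.exists_hasCompactSupport_lintegral_sub_le
    (ENNReal.div_pos hε.ne' (by norm_num : (4 : ENNReal) ≠ ⊤)).ne'
  obtain ⟨η, hη, hηM⟩ : ∃ η : ℝ, 0 < η ∧ ENNReal.ofReal η * ENNReal.ofReal T ≤ ε / 4 := by
    have hε4 : 0 < (ε / 4).toReal := ENNReal.toReal_pos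
      (ENNReal.div_pos hε.ne' (by norm_num)).ne' (ENNReal.div_ne_top hε' (by norm_num))
    refine ⟨(ε / 4).toReal / (|T| + 1), by positivity, ?_⟩
    rw [← ENNReal.ofReal_mul (by positivity)]
    refine ENNReal.ofReal_le_of_le_toReal ?_
    rw [div_mul_eq_mul_div, div_le_iff₀ (by positivity)]
    nlinarith [le_abs_self T]
  filter_upwards [Metric.tendstoUniformlyOn_iff.1
    (tendstoUniformlyOn_step_comp hP hgc.continuousOn) η hη] with n hn
  set c : ℕ → X := fun k => g ((P n).t k)
  have hvc : ∫⁻ t in Set.Icc 0 T, ‖v t - (P n).step c t‖ₑ ≤ ε / 4 + ε / 4 := by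
    calc ∫⁻ t in Set.Icc 0 T, ‖v t - (P n).step c t‖ₑ
        ≤ ∫⁻ t in Set.Icc 0 T, (‖v t - g t‖ₑ + ‖g t - (P n).step c t‖ₑ) :=
          lintegral_mono fun t => by
            simpa using enorm_add_le (v t - g t) (g t - (P n).step c t)
      _ = (∫⁻ t in Set.Icc 0 T, ‖v t - g t‖ₑ) +
            ∫⁻ t in Set.Icc 0 T, ‖g t - (P n).step c t‖ₑ :=
          lintegral_add_left' (h.1.aestronglyMeasurable.sub
            hgc.aestronglyMeasurable).enorm _
      _ ≤ ε / 4 + ∫⁻ _ in Set.Icc 0 T, ENNReal.ofReal η := by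
          refine add_le_add hg (setLIntegral_mono measurable_const fun t ht => ?_)
          rw [← ofReal_norm, ← dist_eq_norm]
          exact ENNReal.ofReal_le_ofReal (hn t ht).le
      _ ≤ ε / 4 + ε / 4 := by
          rw [setLIntegral_const, Real.volume_Icc, sub_zero]
          gcongr
  calc ∫⁻ t in Set.Icc 0 T, ‖(P n).step ((P n).diffQuot x) t - v t‖ₑ
      ≤ ∫⁻ t in Set.Icc 0 T, (‖(P n).step (fun k => (P n).diffQuot x k - c k) t‖ₑ +
          ‖v t - (P n).step c t‖ₑ) := lintegral_mono fun t => by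
        have := enorm_sub_le (a := (P n).step (fun k => (P n).diffQuot x k - c k) t)
          (b := v t - (P n).step c t)
        simpa [TimePartition.step_eq] using this
    _ = (∫⁻ t in Set.Icc 0 T, ‖(P n).step (fun k => (P n).diffQuot x k - c k) t‖ₑ) +
          ∫⁻ t in Set.Icc 0 T, ‖v t - (P n).step c t‖ₑ :=
        lintegral_add_left ((P n).stronglyMeasurable_step _).enorm _
    _ ≤ (ε / 4 + ε / 4) + (ε / 4 + ε / 4) :=
        add_le_add ((h.lintegral_diffQuot_sub_step_le (P n) c).trans hvc) hvc
    _ = ε := by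
        rw [show ε / 4 + ε / 4 + (ε / 4 + ε / 4) = 4 * (ε / 4) by ring,
          ENNReal.mul_div_cancel (by norm_num) (by norm_num)]

end W11

/-! ### Dependence of the implicit scheme on the inhomogeneity -/

section Perturbation

variable {X : Type*} [NormedAddCommGroup X] [InnerProductSpace ℝ X] {T : ℝ}
  {A : ℝ → Set (X × X)}

theorem IsImplicitScheme.exists_of_isMaximalMonotoneRel [CompleteSpace X]
    (hA : ∀ t ∈ Set.Icc 0 T, IsMaximalMonotoneRel (A t)) (P : TimePartition T) (g : ℕ → X)
    (x₀ : X) : ∃ ξ, IsImplicitScheme A P g x₀ ξ := by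
  have hstep : ∀ (k : ℕ) (ξ : X), ∃ ξ' : X, k < P.m → ∃ y ∈ relImage (A (P.t (k + 1))) ξ',
      (P.t (k + 1) - P.t k)⁻¹ • (ξ' - ξ) = -y + g (k + 1) := by
    intro k ξ
    by_cases hk : k < P.m
    · have hh : 0 < P.t (k + 1) - P.t k := sub_pos.2 (P.t_lt k hk)
      obtain ⟨⟨ξ', y⟩, hq, he⟩ := (hA _ (P.t_mem_Icc hk)).exists_add_smul_eq hh
        (ξ + (P.t (k + 1) - P.t k) • g (k + 1))
      refine ⟨ξ', fun _ => ⟨y, hq, ?_⟩⟩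
      rw [inv_smul_eq_iff₀ hh.ne', smul_add, smul_neg, ← sub_eq_zero]
      rw [← sub_eq_zero] at he
      rw [← he]
      abel
    · exact ⟨0, fun h => absurd h hk⟩
  choose F hF using hstep
  exact ⟨fun k => Nat.rec x₀ F k, rfl, fun k hk => hF k _ hk⟩

/-- The resolvents of monotone operators are contractions, so that the errors of the implicit
scheme add up to the `L¹` distance of the inhomogeneities. -/
theorem IsImplicitScheme.norm_sub_le (hA : ∀ t ∈ Set.Icc 0 T, IsMonotoneRel (A t))
    {P : TimePartition T} {g g' : ℕ → X} {x₀ : X} {ξ ξ' : ℕ → X}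
    (h : IsImplicitScheme A P g x₀ ξ) (h' : IsImplicitScheme A P g' x₀ ξ') {k : ℕ}
    (hk : k ≤ P.m) :
    ‖ξ k - ξ' k‖ ≤
      ∑ j ∈ Finset.range k, (P.t (j + 1) - P.t j) * ‖g (j + 1) - g' (j + 1)‖ := by
  induction k with
  | zero => simp [h.1, h'.1]
  | succ k ih =>
    have ih := ih (by omega)
    rw [Finset.sum_range_succ]
    have hh : 0 < P.t (k + 1) - P.t k := sub_pos.2 (P.t_lt k hk)
    obtain ⟨y, hy, he⟩ := h.2 k hk
    obtain ⟨y', hy', he'⟩ := h'.2 k hk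
    rw [inv_smul_eq_iff₀ hh.ne'] at he he'
    have hmono := mul_nonneg hh.le (hA _ (P.t_mem_Icc hk) _ hy _ hy')
    set τ := P.t (k + 1) - P.t k
    simp only [← real_inner_smul_right] at hmono
    set d := ξ (k + 1) - ξ' (k + 1) with hd
    have hsplit : d = (ξ k - ξ' k) + τ • (g (k + 1) - g' (k + 1)) - τ • (y - y') := by
      rw [eq_add_of_sub_eq he, eq_add_of_sub_eq he'] at hd
      rw [hd]
      module
    have hsq : ‖d‖ * ‖d‖ ≤ ‖d‖ * (‖ξ k - ξ' k‖ + τ * ‖g (k + 1) - g' (k + 1)‖) := by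
      calc ‖d‖ * ‖d‖ = inner ℝ d d := (real_inner_self_eq_norm_mul_norm d).symm
        _ = inner ℝ d ((ξ k - ξ' k) + τ • (g (k + 1) - g' (k + 1))) -
              inner ℝ d (τ • (y - y')) := by rw [← inner_sub_right, ← hsplit]
        _ ≤ inner ℝ d ((ξ k - ξ' k) + τ • (g (k + 1) - g' (k + 1))) := sub_le_self _ hmono
        _ ≤ ‖d‖ * ‖(ξ k - ξ' k) + τ • (g (k + 1) - g' (k + 1))‖ := real_inner_le_norm _ _
        _ ≤ ‖d‖ * (‖ξ k - ξ' k‖ + τ * ‖g (k + 1) - g' (k + 1)‖) := by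
            gcongr
            refine (norm_add_le _ _).trans_eq ?_
            rw [norm_smul, Real.norm_of_nonneg hh.le]
    rcases (norm_nonneg d).eq_or_lt with h0 | h0
    · rw [← h0]
      exact add_nonneg ((norm_nonneg _).trans ih) (mul_nonneg hh.le (norm_nonneg _))
    · exact (le_of_mul_le_mul_left hsq h0).trans (by gcongr)

/-- For maximal monotone operators, inhomogeneities with the same `L¹` limit lead to the same
limits of the implicit scheme along given partitions. -/
theorem IsSchemeLimit.congr_inhom [CompleteSpace X]
    (hA : ∀ t ∈ Set.Icc 0 T, IsMaximalMonotoneRel (A t)) {P : ℕ → TimePartition T}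
    {g g' : ℕ → ℕ → X} (hg : StepsTendstoL1 T P (fun n k => g n k - g' n k) fun _ => 0)
    {x₀ : X} {x : ℝ → X} (h : IsSchemeLimit T A P g x₀ x) : IsSchemeLimit T A P g' x₀ x := by
  obtain ⟨hc, hm, ξ, hξ, hlim⟩ := h
  choose ξ' hξ' using fun n => IsImplicitScheme.exists_of_isMaximalMonotoneRel hA (P n) (g' n) x₀
  refine ⟨hc, hm, ξ', hξ', ?_⟩
  simp only [stepsTendstoL1_iff, sub_zero, ← TimePartition.ofReal_sum_mul_norm] at hg
  rw [Metric.tendstoUniformlyOn_iff] at hlim ⊢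
  intro ε hε
  filter_upwards [hlim (ε / 2) (half_pos hε), hg.eventually_lt_const
    (ENNReal.ofReal_pos.2 (half_pos hε))] with n h1 h2 t ht
  have hk := (P n).idx_le ht
  have hle := (hξ n).norm_sub_le (fun t ht => (hA t ht).1) (hξ' n) hk
  have hsum := Finset.sum_le_sum_of_subset_of_nonneg (Finset.range_mono hk)
    (f := fun j => ((P n).t (j + 1) - (P n).t j) * ‖g n (j + 1) - g' n (j + 1)‖)
    fun j hj _ => mul_nonneg (sub_nonneg.2 ((P n).t_lt j (Finset.mem_range.1 hj)).le)
      (norm_nonneg _)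
  have h3 := (ENNReal.ofReal_lt_ofReal_iff (half_pos hε)).1 h2
  have h4 := h1 t ht
  rw [TimePartition.step_eq] at h4 ⊢
  refine (dist_triangle _ (ξ n ((P n).idx t)) _).trans_lt ?_
  rw [dist_eq_norm (ξ n _)]
  linarith

end Perturbation

/-! ### Translation by a lifting of the boundary data -/

section Translation

variable {X : Type*} [NormedAddCommGroup X] [InnerProductSpace ℝ X] {m : ℕ} {T : ℝ}
  {𝔄 : Set (X × X)} {p : X →ₗ.[ℝ] EuclideanSpace ℝ (Fin m)}
  {u : ℝ → EuclideanSpace ℝ (Fin m)} {xl dxl : ℝ → X}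

/-- `xl` lifts the boundary data `u`, that is, `𝔭 (xl t) = u t` for all `t`. -/
def IsLifting (p : X →ₗ.[ℝ] EuclideanSpace ℝ (Fin m)) (u : ℝ → EuclideanSpace ℝ (Fin m))
    (xl : ℝ → X) : Prop :=
  ∀ t, ∃ h : xl t ∈ p.domain, p ⟨xl t, h⟩ = u t

theorem isLifting_lift {b : Fin m → p.domain}
    (hb : ∀ i, p (b i) = EuclideanSpace.single i (1 : ℝ)) (u : ℝ → EuclideanSpace ℝ (Fin m)) :
    IsLifting p u (lift (fun i => (b i : X)) u) := by
  intro t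
  have h : lift (fun i => (b i : X)) u t = ((∑ i, u t i • b i : p.domain) : X) := by
    simp [lift]
  have hmem : lift (fun i => (b i : X)) u t ∈ p.domain := h ▸ Subtype.coe_prop _
  refine ⟨hmem, ?_⟩
  have h' : (⟨_, hmem⟩ : p.domain) = ∑ i, u t i • b i := Subtype.ext h
  rw [h', ← LinearPMap.toFun_eq_coe, map_sum]
  simp only [map_smul, LinearPMap.toFun_eq_coe, hb]
  ext j
  simp [Finset.sum_apply, Pi.single_apply]

theorem HasW11Deriv.lift [CompleteSpace X] (hT : 0 ≤ T) (b : Fin m → X)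
    {du : ℝ → EuclideanSpace ℝ (Fin m)} (hu : HasW11Deriv T u du) :
    HasW11Deriv T (lift b u) (lift b du) := by
  have h := hu.clm_comp hT
    (∑ i, (EuclideanSpace.proj (𝕜 := ℝ) i).smulRight (b i) : EuclideanSpace ℝ (Fin m) →L[ℝ] X)
  convert h using 1 <;> ext t <;> simp [BoundaryLifting.lift]

theorem IsLifting.sub_mem_kerSet_iff (hl : IsLifting p u xl) (t : ℝ) (x : X) :
    x - xl t ∈ kerSet p ↔ ∃ h : x ∈ p.domain, p ⟨x, h⟩ = u t := by
  obtain ⟨hd, he⟩ := hl t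
  have hsub : ∀ h : x ∈ p.domain, p ⟨x - xl t, sub_mem h hd⟩ = p ⟨x, h⟩ - u t := fun h => by
    rw [← he, ← LinearPMap.map_sub]
    rfl
  constructor
  · rintro ⟨h, h0⟩
    have hx : x ∈ p.domain := by simpa using add_mem h hd
    exact ⟨hx, sub_eq_zero.1 ((hsub hx).symm.trans h0)⟩
  · rintro ⟨h, h0⟩
    exact ⟨sub_mem h hd, by rw [hsub h, h0, sub_self]⟩

theorem IsLifting.mem_relImage_shiftedOp_iff (hl : IsLifting p u xl) (t : ℝ) (x y : X) :
    y ∈ relImage (shiftedOp 𝔄 p xl t) (x - xl t) ↔ y ∈ relImage (boundaryOp 𝔄 p u t) x := by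
  change (x - xl t ∈ kerSet p ∧ (x - xl t + xl t, y) ∈ 𝔄) ↔ ((x, y) ∈ 𝔄 ∧ ∃ h, _)
  rw [hl.sub_mem_kerSet_iff, sub_add_cancel, and_comm]

theorem mem_relImage_liftedOp_iff (t : ℝ) (z y : X) :
    y ∈ relImage (liftedOp 𝔄 p xl dxl t) z ↔
      y - dxl t ∈ relImage (shiftedOp 𝔄 p xl t) z := by
  constructor
  · rintro ⟨y', hy', he⟩
    simp only at he
    rwa [he, add_sub_cancel_right]
  · exact fun h => ⟨_, h, (sub_add_cancel _ _).symm⟩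

theorem IsLifting.relDom_liftedOp (hl : IsLifting p u xl)
    (hdom : (p.domain : Set X) = relDom 𝔄) (t : ℝ) :
    relDom (liftedOp 𝔄 p xl dxl t) = kerSet p := by
  ext z
  constructor
  · rintro ⟨y, y', ⟨hz, -⟩, -⟩
    exact hz
  · intro hz
    obtain ⟨h, -⟩ := id hz
    have hmem : z + xl t ∈ relDom 𝔄 := hdom ▸ add_mem h (hl t).1
    obtain ⟨y, hy⟩ := hmem
    exact ⟨y + dxl t, y, ⟨hz, hy⟩, rfl⟩

theorem IsLifting.sub_mem_closure_relDom_liftedOp_iff (hl : IsLifting p u xl) (t : ℝ) (x : X) :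
    x - xl t ∈ closure (relDom (liftedOp 𝔄 p xl dxl t)) ↔
      x ∈ closure (relDom (boundaryOp 𝔄 p u t)) := by
  have h : (Homeomorph.addRight (-xl t)) ⁻¹' relDom (liftedOp 𝔄 p xl dxl t) =
      relDom (boundaryOp 𝔄 p u t) := by
    ext z
    change (∃ y, y ∈ relImage (liftedOp 𝔄 p xl dxl t) (z + -xl t)) ↔
      ∃ y, y ∈ relImage (boundaryOp 𝔄 p u t) z
    simp only [← sub_eq_add_neg, mem_relImage_liftedOp_iff, hl.mem_relImage_shiftedOp_iff]
    exact ⟨fun ⟨y, hy⟩ => ⟨_, hy⟩, fun ⟨y, hy⟩ => ⟨y + dxl t, by simpa using hy⟩⟩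
  rw [← h, ← Homeomorph.preimage_closure, Set.mem_preimage, Homeomorph.coe_addRight,
    sub_eq_add_neg]

theorem IsLifting.isStrongSolution_iff (hT : 0 ≤ T) (hl : IsLifting p u xl)
    (hxl : HasW11Deriv T xl dxl) (x₀ : X) (x : ℝ → X) :
    IsStrongSolution T (boundaryOp 𝔄 p u) x₀ x ↔
      IsStrongSolution T (liftedOp 𝔄 p xl dxl) (x₀ - xl 0) (fun t => x t - xl t) := by
  constructor
  · rintro ⟨v, hv, h0, hcl, hae⟩
    refine ⟨fun t => v t - dxl t, by simpa [sub_eq_add_neg] using hv.add hT hxl.neg,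
      by simp [h0], (hl.sub_mem_closure_relDom_liftedOp_iff 0 x₀).2 hcl, ?_⟩
    filter_upwards [hae] with t ⟨y, hy, he⟩
    refine ⟨y + dxl t, ?_, by rw [he]; abel⟩
    rwa [mem_relImage_liftedOp_iff, add_sub_cancel_right, hl.mem_relImage_shiftedOp_iff]
  · rintro ⟨v, hv, h0, hcl, hae⟩
    refine ⟨fun t => v t + dxl t, by simpa using hv.add hT hxl,
      by simpa using h0, (hl.sub_mem_closure_relDom_liftedOp_iff 0 x₀).1 hcl, ?_⟩
    filter_upwards [hae] with t ⟨y, hy, he⟩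
    refine ⟨y - dxl t, ?_, by rw [he]; abel⟩
    rwa [mem_relImage_liftedOp_iff, hl.mem_relImage_shiftedOp_iff] at hy

theorem IsLifting.isImplicitScheme_iff (hl : IsLifting p u xl) (P : TimePartition T)
    (g : ℕ → X) (x₀ : X) (ξ : ℕ → X) :
    IsImplicitScheme (boundaryOp 𝔄 p u) P g x₀ ξ ↔
      IsImplicitScheme (shiftedOp 𝔄 p xl) P (fun k => g k - P.diffQuot xl k) (x₀ - xl 0)
        (fun k => ξ k - xl (P.t k)) := by
  simp only [IsImplicitScheme, P.t_zero, sub_left_inj, hl.mem_relImage_shiftedOp_iff,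
    P.diffQuot_succ]
  refine and_congr_right fun _ => forall₂_congr fun k _ => exists_congr fun y =>
    and_congr_right fun _ => ?_
  rw [sub_sub_sub_comm, smul_sub _ (_ - _) (_ - _), ← add_sub_assoc, sub_left_inj]

theorem IsLifting.isSchemeLimit_iff (hl : IsLifting p u xl)
    (hc : ContinuousOn xl (Set.Icc 0 T)) (P : ℕ → TimePartition T) (g : ℕ → ℕ → X) (x₀ : X)
    (x : ℝ → X) :
    IsSchemeLimit T (boundaryOp 𝔄 p u) P g x₀ x ↔
      IsSchemeLimit T (shiftedOp 𝔄 p xl) P (fun n k => g n k - (P n).diffQuot xl k)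
        (x₀ - xl 0) (fun t => x t - xl t) := by
  constructor
  · rintro ⟨hx, hm, ξ, hξ, hlim⟩
    exact ⟨hx.sub hc, hm, fun n k => ξ n k - xl ((P n).t k),
      fun n => (hl.isImplicitScheme_iff _ _ _ _).1 (hξ n),
      hlim.sub (tendstoUniformlyOn_step_comp hm hc)⟩
  · rintro ⟨hz, hm, ζ, hζ, hlim⟩
    refine ⟨(hz.add hc).congr fun t _ => by simp, hm, fun n k => ζ n k + xl ((P n).t k),
      fun n => (hl.isImplicitScheme_iff _ _ _ _).2 (by simpa using hζ n), ?_⟩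
    refine (hlim.add (tendstoUniformlyOn_step_comp hm hc)).congr_right fun t _ => by simp

theorem isSchemeLimit_liftedOp_iff (P : ℕ → TimePartition T) (z₀ : X) (z : ℝ → X) :
    IsSchemeLimit T (liftedOp 𝔄 p xl dxl) P (fun _ _ => 0) z₀ z ↔
      IsSchemeLimit T (shiftedOp 𝔄 p xl) P (fun n k => -dxl ((P n).t k)) z₀ z := by
  have h : ∀ n ζ, IsImplicitScheme (liftedOp 𝔄 p xl dxl) (P n) (fun _ => 0) z₀ ζ ↔
      IsImplicitScheme (shiftedOp 𝔄 p xl) (P n) (fun k => -dxl ((P n).t k)) z₀ ζ := by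
    intro n ζ
    refine and_congr_right fun _ => forall₂_congr fun k _ => ?_
    simp only [mem_relImage_liftedOp_iff]
    constructor
    · rintro ⟨y, hy, he⟩
      exact ⟨_, hy, by rw [he]; abel⟩
    · rintro ⟨y, hy, he⟩
      exact ⟨y + dxl ((P n).t (k + 1)), by simpa using hy, by rw [he]; abel⟩
  simp only [IsSchemeLimit, h]

theorem IsLifting.isGeneralizedSolutionInhom_iff [CompleteSpace X] (hT : 0 ≤ T)
    (hl : IsLifting p u xl) (hxl : HasW11Deriv T xl dxl) (x₀ : X) (x : ℝ → X) :
    IsGeneralizedSolutionInhom T (boundaryOp 𝔄 p u) (fun _ => 0) x₀ x ↔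
      IsGeneralizedSolutionInhom T (shiftedOp 𝔄 p xl) (fun t => -dxl t) (x₀ - xl 0)
        (fun t => x t - xl t) := by
  have hc := hxl.continuousOn hT
  have hmeas := hxl.1.aestronglyMeasurable
  constructor
  · rintro ⟨P, g, hg, hlim⟩
    refine ⟨P, _, ?_, (hl.isSchemeLimit_iff hc P g x₀ x).1 hlim⟩
    simpa using hg.sub (hxl.stepsTendstoL1_diffQuot hlim.2.1) aestronglyMeasurable_const hmeas
  · rintro ⟨P, g, hg, hlim⟩
    have hq := (stepsTendstoL1_zero P).sub (hxl.stepsTendstoL1_diffQuot hlim.2.1)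
      aestronglyMeasurable_const hmeas
    refine ⟨P, fun n k => g n k - (0 - (P n).diffQuot xl k), ?_,
      (hl.isSchemeLimit_iff hc P _ x₀ x).2 (by simpa using hlim)⟩
    simpa using hg.sub hq hmeas.neg (aestronglyMeasurable_const.sub hmeas)

theorem isGeneralizedSolution_iff_inhom [CompleteSpace X] {A : ℝ → Set (X × X)}
    (hA : ∀ t ∈ Set.Icc 0 T, IsMaximalMonotoneRel (A t)) (x₀ : X) (x : ℝ → X) :
    IsGeneralizedSolution T A x₀ x ↔ IsGeneralizedSolutionInhom T A (fun _ => 0) x₀ x := by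
  constructor
  · rintro ⟨P, h⟩
    exact ⟨P, _, stepsTendstoL1_zero P, h⟩
  · rintro ⟨P, g, hg, h⟩
    exact ⟨P, h.congr_inhom hA (by simpa using hg)⟩

theorem IsLifting.isSchemeLimit_liftedOp_iff [CompleteSpace X] (hT : 0 ≤ T)
    (hl : IsLifting p u xl) (hxl : HasW11Deriv T xl dxl)
    (hA : ∀ t ∈ Set.Icc 0 T, IsMaximalMonotoneRel (boundaryOp 𝔄 p u t))
    {P : ℕ → TimePartition T} (hP : StepsTendstoL1 T P (fun n k => dxl ((P n).t k)) dxl)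
    (x₀ : X) (x : ℝ → X) :
    IsSchemeLimit T (boundaryOp 𝔄 p u) P (fun _ _ => 0) x₀ x ↔
      IsSchemeLimit T (liftedOp 𝔄 p xl dxl) P (fun _ _ => 0) (x₀ - xl 0)
        (fun t => x t - xl t) := by
  have hmeas := hxl.1.aestronglyMeasurable
  -- In terms of `x`, the scheme for `z` has the inhomogeneities `diffQuot xl k - dxl (t k)`.
  have hz := hl.isSchemeLimit_iff (𝔄 := 𝔄) (hxl.continuousOn hT) P
    (fun n k => (P n).diffQuot xl k - dxl ((P n).t k)) x₀ x
  simp only [sub_sub_cancel_left] at hz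
  rw [BoundaryLifting.isSchemeLimit_liftedOp_iff, ← hz]
  constructor
  · intro h
    refine h.congr_inhom hA ?_
    simpa using hP.sub (hxl.stepsTendstoL1_diffQuot h.2.1) hmeas hmeas
  · intro h
    refine h.congr_inhom hA ?_
    simpa using (hxl.stepsTendstoL1_diffQuot h.2.1).sub hP hmeas hmeas

end Translation

end BoundaryLifting

theorem lemma2p9 {X : Type*} [NormedAddCommGroup X] [InnerProductSpace ℝ X] [CompleteSpace X]
    {m : ℕ} (T : ℝ) (hT : 0 < T)
    (u du : ℝ → EuclideanSpace ℝ (Fin m)) (hu : BoundaryLifting.HasW11Deriv T u du)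
    (𝔄 : Set (X × X)) (p : X →ₗ.[ℝ] EuclideanSpace ℝ (Fin m))
    (hdom : (p.domain : Set X) = BoundaryLifting.relDom 𝔄) (hp : Function.Surjective p)
    (b : Fin m → p.domain) (hb : ∀ i, p (b i) = EuclideanSpace.single i (1 : ℝ))
    (xl dxl : ℝ → X) (hxl : xl = BoundaryLifting.lift (fun i => (b i : X)) u)
    (hdxl : dxl = BoundaryLifting.lift (fun i => (b i : X)) du) :
    -- the lifting lies in `W^{1,1}`, and the domain of the lifted operators is constant
    BoundaryLifting.HasW11Deriv T xl dxl ∧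
    (∀ t ∈ Set.Icc 0 T,
      BoundaryLifting.relDom (BoundaryLifting.liftedOp 𝔄 p xl dxl t) =
        BoundaryLifting.kerSet p) ∧
    -- strong solutions
    (∀ (x₀ : X) (x : ℝ → X),
      BoundaryLifting.IsStrongSolution T (BoundaryLifting.boundaryOp 𝔄 p u) x₀ x ↔
        BoundaryLifting.IsStrongSolution T (BoundaryLifting.liftedOp 𝔄 p xl dxl)
          (x₀ - xl 0) (fun t => x t - xl t)) ∧
    -- generalized solutions, with `L¹`-convergent inhomogeneities in both schemes
    (∀ (x₀ : X) (x : ℝ → X),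
      BoundaryLifting.IsGeneralizedSolutionInhom T (BoundaryLifting.boundaryOp 𝔄 p u)
          (fun _ => 0) x₀ x ↔
        BoundaryLifting.IsGeneralizedSolutionInhom T (BoundaryLifting.shiftedOp 𝔄 p xl)
          (fun t => -dxl t) (x₀ - xl 0) (fun t => x t - xl t)) ∧
    -- generalized solutions, maximal monotone operators
    ((∀ t ∈ Set.Icc 0 T,
        BoundaryLifting.IsMaximalMonotoneRel (BoundaryLifting.boundaryOp 𝔄 p u t)) →
      -- the scheme for `x` may be taken without inhomogeneity
      (∀ (x₀ : X) (x : ℝ → X),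
        BoundaryLifting.IsGeneralizedSolution T (BoundaryLifting.boundaryOp 𝔄 p u) x₀ x ↔
          BoundaryLifting.IsGeneralizedSolutionInhom T (BoundaryLifting.shiftedOp 𝔄 p xl)
            (fun t => -dxl t) (x₀ - xl 0) (fun t => x t - xl t)) ∧
      -- the scheme for `z` may be taken with the nodal values of the derivative of the lifting,
      -- along all partitions for which these values approximate that derivative in `L¹`
      (∀ P : ℕ → BoundaryLifting.TimePartition T,
        BoundaryLifting.StepsTendstoL1 T P (fun n k => dxl ((P n).t k)) dxl →
        ∀ (x₀ : X) (x : ℝ → X),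
          BoundaryLifting.IsSchemeLimit T (BoundaryLifting.boundaryOp 𝔄 p u) P
              (fun _ _ => 0) x₀ x ↔
            BoundaryLifting.IsSchemeLimit T (BoundaryLifting.liftedOp 𝔄 p xl dxl) P
              (fun _ _ => 0) (x₀ - xl 0) (fun t => x t - xl t))) := by
  have hl : BoundaryLifting.IsLifting p u xl := hxl ▸ BoundaryLifting.isLifting_lift hb u
  have hW : BoundaryLifting.HasW11Deriv T xl dxl := by
    rw [hxl, hdxl]
    exact hu.lift hT.le _
  refine ⟨hW, fun t _ => hl.relDom_liftedOp hdom t, hl.isStrongSolution_iff hT.le hW,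
    hl.isGeneralizedSolutionInhom_iff hT.le hW, fun hA => ⟨fun x₀ x => ?_, fun P hP =>
      hl.isSchemeLimit_liftedOp_iff hT.le hW hA hP⟩⟩
  rw [BoundaryLifting.isGeneralizedSolution_iff_inhom hA,
    hl.isGeneralizedSolutionInhom_iff hT.le hW]
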